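/- Let $d\in\mathbb N$. A rational polyhedron in $\mathbb R^d$ is the solution set of a finite system of linear inequalities $\langle a,x\rangle\le b$ with $a\in\mathbb Q^d$, $b\in\mathbb Q$; a rational halfspace is a set $\{x\in\mathbb R^d:\langle a,x\rangle\le b\}$ with $a\in\mathbb Q^d\setminus\{0\}$, $b\in\mathbb Q$. For a $d$-dimensional polyhedron $L$ and $X\subseteq\mathbb R^d$ put $R_L(X):=\operatorname{conv}(X\setminus\operatorname{int}L)$. For a $d$-dimensional rational polyhedron $L\ne\mathbb R^d$ whose recession cone is a linear space, let $m(L)$ be the least positive integer $m$ for which there are $n\ge 1$, $a_1,\dots,a_n\in\mathbb Z^d\setminus\{0\}$ and $b_1,\dots,b_n\in\mathbb Z$ with $L=\{x\in\mathbb R^d: b_i-m\le\langle a_i,x\rangle\le b_i \text{ for } i=1,\dots,n\}$; let $m(L):=+\infty$ if $L=\mathbb R^d$ or the recession cone of $L$ is not a linear space. For a family $\mathcal L$ of $d$-dimensional rational polyhedra put $m(\mathcal L):=\sup_{L\in\mathcal L}m(L)$. A closed halfspace $H$ is called an $\mathcal L$-cut for $P$ if $P\setminus\operatorname{int}L\subseteq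 H$ for some $L\in\mathcal L$. Intersections of empty families of subsets of $\mathbb R^d$ are $\mathbb R^d$. Let $P$ be a rational polyhedron in $\mathbb R^d$. (a) Let $\mathcal L$ be a family of $d$-dimensional rational polyhedra in $\mathbb R^d$ with $m(\mathcal L)<+\infty$. Then there exists a finite family $\mathcal H$ of $\mathcal L$-cuts for $P$ such that each $H\in\mathcal H$ is a rational halfspace and $\bigcap_{L\in\mathcal L}R_L(P)=\bigcap_{H\in\mathcal H}H$. In particular, $\bigcap_{L\in\mathcal L}R_L(P)$ is a rational polyhedron. (b) The Chvátal–Gomory closure of $P$, that is, the set of all $x\in P$ such that $\langle a,x\rangle\le\lfloor b\rfloor$ for all $a\in\mathbb Z^d$, $b\in\mathbb R$ for which $\langle a,y\rangle\le b$ holds for all $y\in P$, is a rational polyhedron. (c) The split closure of $P$, that is, $\bigcap_L R_L(P)$ over all split sets $L=\{x\in\mathbb R^d: i-1\le\langle a,x\rangle\le i\}$ with $a\in\mathbb Z^d\setminus\{0\}$, $i\in\mathbb Z$, is a rational polyhedron. -/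

import Mathlib

open scoped Matrix

namespace CutClosure

/-- `H` is a closed halfspace of `ℝ^d`. -/
def IsClosedHalfspace {d : ℕ} (H : Set (Fin d → ℝ)) : Prop :=
  ∃ (a : Fin d → ℝ) (b : ℝ), a ≠ 0 ∧ H = {x | a ⬝ᵥ x ≤ b}

/-- `H` is a rational (closed) halfspace of `ℝ^d`. -/
def IsRationalHalfspace {d : ℕ} (H : Set (Fin d → ℝ)) : Prop :=
  ∃ (a : Fin d → ℚ) (b : ℚ), a ≠ 0 ∧ H = {x | (fun j => (a j : ℝ)) ⬝ᵥ x ≤ (b : ℝ)}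

/-- `P` is a rational polyhedron: the solution set of a finite (possibly empty or infeasible)
system of non-strict linear inequalities with rational coefficients. -/
def IsRationalPolyhedron {d : ℕ} (P : Set (Fin d → ℝ)) : Prop :=
  ∃ (n : ℕ) (a : Fin n → Fin d → ℚ) (b : Fin n → ℚ),
    P = {x | ∀ i, (fun j => (a i j : ℝ)) ⬝ᵥ x ≤ (b i : ℝ)}

/-- `L` is `d`-dimensional: its affine hull is the whole of `ℝ^d`. -/
def IsFullDimensional {d : ℕ} (L : Set (Fin d → ℝ)) : Prop :=
  affineSpan ℝ L = ⊤

/-- The recession cone of `L`. -/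
def recessionCone {d : ℕ} (L : Set (Fin d → ℝ)) : Set (Fin d → ℝ) :=
  {u | ∀ x ∈ L, ∀ t : ℝ, 0 ≤ t → x + t • u ∈ L}

/-- `S` is a linear subspace of `ℝ^d`. -/
def IsLinearSpace {d : ℕ} (S : Set (Fin d → ℝ)) : Prop :=
  ∃ V : Submodule ℝ (Fin d → ℝ), (V : Set (Fin d → ℝ)) = S

/-- The operator `R_L(X) = conv (X \ int L)`. -/
def R {d : ℕ} (L X : Set (Fin d → ℝ)) : Set (Fin d → ℝ) :=
  convexHull ℝ (X \ interior L)

/-- `L = {x | b_i - m ≤ ⟨a_i, x⟩ ≤ b_i for all i ∈ [n]}` for some `n ≥ 1`,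
nonzero integer vectors `a_i` and integers `b_i`. -/
def HasWidthRepresentation {d : ℕ} (L : Set (Fin d → ℝ)) (m : ℕ) : Prop :=
  ∃ (n : ℕ) (a : Fin n → Fin d → ℤ) (b : Fin n → ℤ), 1 ≤ n ∧ (∀ i, a i ≠ 0) ∧
    L = {x | ∀ i, (b i : ℝ) - (m : ℝ) ≤ (fun j => (a i j : ℝ)) ⬝ᵥ x ∧
      (fun j => (a i j : ℝ)) ⬝ᵥ x ≤ (b i : ℝ)}

open Classical in
/-- The max-facet-width `m(L)` of a `d`-dimensional rational polyhedron `L`: the least positive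
integer `m` for which `L` has a representation as above when `L ≠ ℝ^d` and the recession cone of
`L` is a linear space, and `+∞` otherwise. -/
noncomputable def maxFacetWidth {d : ℕ} (L : Set (Fin d → ℝ)) : ℕ∞ :=
  if L ≠ Set.univ ∧ IsLinearSpace (recessionCone L) then
    ⨅ (m : ℕ) (_ : 1 ≤ m ∧ HasWidthRepresentation L m), (m : ℕ∞)
  else ⊤

/-- `m(𝓛)`, the supremum of `m(L)` over the members `L` of the family `𝓛`. -/
noncomputable def familyMaxFacetWidth {d : ℕ} (𝓛 : Set (Set (Fin d → ℝ))) : ℕ∞ :=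
  ⨆ L ∈ 𝓛, maxFacetWidth L

/-- The closed halfspace `H` is an `𝓛`-cut for `P`. -/
def IsCut {d : ℕ} (𝓛 : Set (Set (Fin d → ℝ))) (P H : Set (Fin d → ℝ)) : Prop :=
  IsClosedHalfspace H ∧ ∃ L ∈ 𝓛, P \ interior L ⊆ H

/-- The family of all split sets `{x | i - 1 ≤ ⟨a, x⟩ ≤ i}`, with `a` a nonzero integer vector and
`i` an integer. -/
def splitSets (d : ℕ) : Set (Set (Fin d → ℝ)) :=
  {L | ∃ (a : Fin d → ℤ) (i : ℤ), a ≠ 0 ∧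
    L = {x | (i : ℝ) - 1 ≤ (fun j => (a j : ℝ)) ⬝ᵥ x ∧ (fun j => (a j : ℝ)) ⬝ᵥ x ≤ (i : ℝ)}}

/-- The split closure `⋂_L R_L(P)` of `P`, over all split sets `L`. -/
def splitClosure {d : ℕ} (P : Set (Fin d → ℝ)) : Set (Fin d → ℝ) :=
  ⋂ L ∈ splitSets d, R L P

/-- The Chvátal–Gomory closure of `P`: the points of `P` that satisfy `⟨a, x⟩ ≤ ⌊b⌋` for every
inequality `⟨a, x⟩ ≤ b` with integer `a` that is valid on `P`. -/
def chvatalGomoryClosure {d : ℕ} (P : Set (Fin d → ℝ)) : Set (Fin d → ℝ) :=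
  {x | x ∈ P ∧ ∀ (a : Fin d → ℤ) (b : ℝ),
    (∀ y ∈ P, (fun j => (a j : ℝ)) ⬝ᵥ y ≤ b) → (fun j => (a j : ℝ)) ⬝ᵥ x ≤ (⌊b⌋ : ℝ)}

end CutClosure

namespace CutClosure

open Matrix (vecCons vecHead vecTail)

/-! Think of P as the convex hull of finitely many rational points p plus the cone of finitely many
rational directions e. Let D be a common denominator of their coordinates, M a bound on all widths,
and N = (M * D)!. If p lies in int L, the reciprocal of the time at which the ray from p along u
leaves int L is the largest positive ⟨c_r, u⟩ / (β_r - ⟨c_r, p⟩) over the rows r of L, or 0 if it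
never leaves. The width bound makes D(β_r - ⟨c_r, p⟩) an integer between 1 and M * D, so this
reciprocal is k / N with k a natural number (`exists_exit_index`). Thus L matters only through the
set of p's in its interior and a finite table k of naturals.

R_L(P) is the convex hull of the exit points plus the cone of the e's, hence a rational polyhedron.
For a fixed set of interior p's, larger entries of k mean earlier exits and a larger R_L(P): a
multiplier argument (`valid_of_valid_on_exitPoints`) shows that inequalities valid for the larger
table hold for the smaller one, and `exists_outer_description` turns this into an inclusion. By
Dickson's lemma (`exists_finite_dominating`) finitely many L already give the whole intersection,
and each contributes finitely many rational cuts.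

Split sets have width one, and the Chvátal–Gomory closure is P intersected with R_L(P) for the
splits just above the rounded bounds (`R_split_eq`). -/

/-! ### Polyhedral cones over a subfield of ℝ -/

/-- Fourier–Motzkin elimination: adding a ray to a polyhedral cone gives a polyhedral cone. -/
theorem exists_forms_add_ray {ι : Type*} [Fintype ι] (F : Subfield ℝ) {U : Set (ι → ℝ)}
    (hU : U.Finite) (hUF : ∀ r ∈ U, ∀ j, r j ∈ F) {w : ι → ℝ} (hw : ∀ j, w j ∈ F) :
    ∃ U' : Set (ι → ℝ), U'.Finite ∧ (∀ r ∈ U', ∀ j, r j ∈ F) ∧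
      ∀ y, (∀ r ∈ U', 0 ≤ r ⬝ᵥ y) ↔ ∃ t : ℝ, 0 ≤ t ∧ ∀ r ∈ U, 0 ≤ r ⬝ᵥ (y - t • w) := by
  have hdot : ∀ r ∈ U, r ⬝ᵥ w ∈ F := fun r hr =>
    F.sum_mem fun j _ => F.mul_mem (hUF r hr j) (hw j)
  -- Rows negative on `w` bound `t` from below, rows positive on `w` bound it from above. The first
  -- set pairs the upper bounds with `0 ≤ t`, the second pairs each upper with each lower bound so
  -- that `w` cancels.
  refine ⟨{r ∈ U | 0 ≤ r ⬝ᵥ w} ∪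
    Set.image2 (fun p q => (p ⬝ᵥ w) • q - (q ⬝ᵥ w) • p) {p ∈ U | 0 < p ⬝ᵥ w} {q ∈ U | q ⬝ᵥ w < 0},
    (hU.subset (Set.sep_subset _ _)).union
      ((hU.subset (Set.sep_subset _ _)).image2 _ (hU.subset (Set.sep_subset _ _))), ?_, ?_⟩
  · rintro r (hr | ⟨p, hp, q, hq, rfl⟩) j
    · exact hUF r hr.1 j
    · exact F.sub_mem (F.mul_mem (hdot p hp.1) (hUF q hq.1 j))
        (F.mul_mem (hdot q hq.1) (hUF p hp.1 j))
  · intro y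
    simp only [dotProduct_sub, dotProduct_smul, smul_eq_mul]
    constructor
    · intro h
      -- The largest lower bound, including 0, is the smallest candidate for `t`.
      obtain ⟨t, ht, hmax⟩ := Set.exists_max_image
        (insert 0 ((fun q => q ⬝ᵥ y / q ⬝ᵥ w) '' {q ∈ U | q ⬝ᵥ w < 0})) id
        (((hU.subset (Set.sep_subset _ _)).image _).insert 0) ⟨0, Set.mem_insert _ _⟩
      refine ⟨t, hmax 0 (Set.mem_insert _ _), fun r hr => ?_⟩
      rcases lt_trichotomy (r ⬝ᵥ w) 0 with hneg | hzero | hpos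
      · have := hmax _ (Set.mem_insert_of_mem _ ⟨r, ⟨hr, hneg⟩, rfl⟩)
        simp only [id] at this
        rw [div_le_iff_of_neg hneg] at this
        linarith
      · have := h r (Or.inl ⟨hr, hzero.ge⟩)
        rw [hzero]; linarith
      · rcases ht with rfl | ⟨q, hq, rfl⟩
        · have := h r (Or.inl ⟨hr, hpos.le⟩)
          linarith
        · have := h _ (Or.inr ⟨r, ⟨hr, hpos⟩, q, hq, rfl⟩)
          simp only [sub_dotProduct, smul_dotProduct, smul_eq_mul] at this
          have hq' : q ⬝ᵥ w < 0 := hq.2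
          have e : r ⬝ᵥ y - q ⬝ᵥ y / q ⬝ᵥ w * r ⬝ᵥ w
              = (r ⬝ᵥ w * q ⬝ᵥ y - q ⬝ᵥ w * r ⬝ᵥ y) / (- (q ⬝ᵥ w)) := by
            field_simp [hq'.ne]
            ring
          rw [e]
          exact div_nonneg this (by linarith)
    · rintro ⟨t, ht, h⟩ r (hr | ⟨p, hp, q, hq, rfl⟩)
      · have := h r hr.1
        have := mul_nonneg ht hr.2
        linarith
      · simp only [sub_dotProduct, smul_dotProduct, smul_eq_mul]
        have h1 := mul_nonneg hp.2.le (h q hq.1)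
        have h2 := mul_nonneg (neg_nonneg.2 hq.2.le) (h p hp.1)
        linarith

/-- Weyl's theorem over a subfield of `ℝ`: a finitely generated cone is polyhedral. -/
theorem exists_forms_of_generators {ι : Type*} [Fintype ι] (F : Subfield ℝ) {T : Set (ι → ℝ)}
    (hT : T.Finite) (hTF : ∀ r ∈ T, ∀ j, r j ∈ F) :
    ∃ U : Set (ι → ℝ), U.Finite ∧ (∀ r ∈ U, ∀ j, r j ∈ F) ∧
      ∀ y, (∀ r ∈ U, 0 ≤ r ⬝ᵥ y) ↔ y ∈ Submodule.span NNReal T := by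
  classical
  induction T, hT using Set.Finite.induction_on with
  | empty =>
    refine ⟨Set.range (fun j => Pi.single j 1) ∪ Set.range (fun j => -Pi.single j 1),
      (Set.finite_range _).union (Set.finite_range _), ?_, fun y => ?_⟩
    · have h1 : ∀ i j, (Pi.single i 1 : ι → ℝ) j ∈ F := fun i j => by
        rw [Pi.single_apply]; split_ifs
        exacts [F.one_mem, F.zero_mem]
      rintro r (⟨i, rfl⟩ | ⟨i, rfl⟩) j
      · exact h1 i j
      · exact F.neg_mem (h1 i j)
    · simp only [Submodule.span_empty, Submodule.mem_bot]
      constructor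
      · intro h
        ext j
        have h1 := h _ (Or.inl ⟨j, rfl⟩)
        have h2 := h _ (Or.inr ⟨j, rfl⟩)
        simp only [neg_dotProduct, single_dotProduct, one_mul] at h1 h2
        exact le_antisymm (neg_nonneg.1 h2) h1
      · rintro rfl r -
        simp
  | @insert w T _ _ ih =>
    obtain ⟨U, hU, hUF, hspan⟩ := ih fun r hr => hTF r (Set.mem_insert_of_mem _ hr)
    obtain ⟨U', hU', hUF', h⟩ := exists_forms_add_ray F hU hUF (hTF w (Set.mem_insert _ _))
    refine ⟨U', hU', hUF', fun y => ?_⟩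
    rw [h, Submodule.mem_span_insert]
    constructor
    · rintro ⟨t, ht, h⟩
      exact ⟨t.toNNReal, _, (hspan _).1 h, by
        rw [NNReal.smul_def, Real.coe_toNNReal t ht, add_sub_cancel]⟩
    · rintro ⟨a, z, hz, rfl⟩
      refine ⟨a, a.2, ?_⟩
      rw [← NNReal.smul_def, add_sub_cancel_left]
      exact (hspan z).2 hz

theorem dotProduct_nonneg_of_mem_span {ι : Type*} [Fintype ι] {T : Set (ι → ℝ)} {h : ι → ℝ}
    (hT : ∀ r ∈ T, 0 ≤ h ⬝ᵥ r) {y : ι → ℝ} (hy : y ∈ Submodule.span NNReal T) :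
    0 ≤ h ⬝ᵥ y := by
  induction hy using Submodule.span_induction with
  | mem x hx => exact hT x hx
  | zero => simp
  | add x y _ _ hx hy => rw [dotProduct_add]; exact add_nonneg hx hy
  | smul a x _ hx =>
    rw [NNReal.smul_def, dotProduct_smul]; exact mul_nonneg a.2 hx

/-- Minkowski's theorem over a subfield of `ℝ`: a polyhedral cone is finitely generated. -/
theorem exists_generators_of_forms {ι : Type*} [Fintype ι] (F : Subfield ℝ) {S : Set (ι → ℝ)}
    (hS : S.Finite) (hSF : ∀ r ∈ S, ∀ j, r j ∈ F) :
    ∃ T : Set (ι → ℝ), T.Finite ∧ (∀ r ∈ T, ∀ j, r j ∈ F) ∧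
      ∀ y, (∀ r ∈ S, 0 ≤ r ⬝ᵥ y) ↔ y ∈ Submodule.span NNReal T := by
  -- Duality: `T` generates the dual of the cone of `S`, and a form in `U`, being nonnegative on
  -- `T`, lies in the cone of `S`.
  obtain ⟨T, hT, hTF, hTS⟩ := exists_forms_of_generators F hS hSF
  obtain ⟨U, hU, hUF, hUT⟩ := exists_forms_of_generators F hT hTF
  refine ⟨T, hT, hTF, fun y => ⟨fun h => ?_, fun h r hr => ?_⟩⟩
  · refine (hUT y).1 fun r hr => ?_
    have : r ∈ Submodule.span NNReal S := (hTS r).1 fun w hw => by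
      rw [dotProduct_comm]; exact (hUT w).2 (Submodule.subset_span hw) r hr
    rw [dotProduct_comm]
    exact dotProduct_nonneg_of_mem_span (fun s hs => by rw [dotProduct_comm]; exact h s hs) this
  · refine dotProduct_nonneg_of_mem_span (fun w hw => ?_) h
    rw [dotProduct_comm]
    exact (hTS r).2 (Submodule.subset_span hr) w hw

/-! ### Rational polyhedra and their generators -/

/-- The rational numbers, as a subfield of `ℝ`. -/
noncomputable def rationals : Subfield ℝ := (Rat.castHom ℝ).fieldRange

theorem mem_rationals {x : ℝ} : x ∈ rationals ↔ ∃ q : ℚ, (q : ℝ) = x := by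
  simp [rationals, RingHom.mem_fieldRange]

theorem ratCast_mem_rationals (q : ℚ) : (q : ℝ) ∈ rationals := mem_rationals.2 ⟨q, rfl⟩

theorem vecCons_mem {n : ℕ} {F : Subfield ℝ} {t : ℝ} {x : Fin n → ℝ} (ht : t ∈ F)
    (hx : ∀ j, x j ∈ F) (j : Fin (n + 1)) : vecCons t x j ∈ F := by
  refine Fin.cases ?_ (fun j => ?_) j
  · exact ht
  · exact hx j

/-- A finite family of rationals has a common denominator. -/
theorem exists_common_denominator {K : Type*} [Finite K] (f : K → ℝ) (hf : ∀ k, f k ∈ rationals) :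
    ∃ D : ℕ, 0 < D ∧ ∀ k, ∃ z : ℤ, (D : ℝ) * f k = z := by
  classical
  have := Fintype.ofFinite K
  choose q hq using fun k => mem_rationals.1 (hf k)
  refine ⟨∏ k, (q k).den, Finset.prod_pos fun k _ => (q k).den_pos, fun k => ?_⟩
  refine ⟨(∏ l ∈ Finset.univ.erase k, ((q l).den : ℤ)) * (q k).num, ?_⟩
  rw [← Finset.mul_prod_erase _ _ (Finset.mem_univ k), ← hq]
  have : ((q k).den : ℝ) * (q k : ℝ) = (q k).num := by
    exact_mod_cast Rat.den_mul_eq_num (q k)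
  push_cast
  rw [← this]
  ring

theorem IsRationalPolyhedron.convex {d : ℕ} {P : Set (Fin d → ℝ)} (hP : IsRationalPolyhedron P) :
    Convex ℝ P := by
  obtain ⟨n, a, b, rfl⟩ := hP
  intro x hx y hy s t hs ht hst i
  rw [dotProduct_add, dotProduct_smul, dotProduct_smul, smul_eq_mul, smul_eq_mul]
  have h1 := mul_le_mul_of_nonneg_left (hx i) hs
  have h2 := mul_le_mul_of_nonneg_left (hy i) ht
  have : s * (b i : ℝ) + t * b i = b i := by rw [← add_mul, hst, one_mul]
  linarith

/-- Generators of a rational polyhedron: finitely many rational points and rational directions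
such that an affine inequality is valid as soon as it is valid on them. -/
theorem IsRationalPolyhedron.exists_generators {d : ℕ} {P : Set (Fin d → ℝ)}
    (hP : IsRationalPolyhedron P) :
    ∃ (I J : Type) (_ : Finite I) (_ : Finite J) (p : I → Fin d → ℝ) (e : J → Fin d → ℝ),
      (∀ i j, p i j ∈ rationals) ∧ (∀ i j, e i j ∈ rationals) ∧ (∀ i, p i ∈ P) ∧
      (∀ x ∈ P, ∀ j, ∀ t : ℝ, 0 ≤ t → x + t • e j ∈ P) ∧
      ∀ (h : Fin d → ℝ) (γ : ℝ), (∀ i, h ⬝ᵥ p i ≤ γ) → (∀ j, h ⬝ᵥ e j ≤ 0) →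
        ∀ x ∈ P, h ⬝ᵥ x ≤ γ := by
  obtain ⟨n, a, b, rfl⟩ := hP
  -- Homogenization: `T` generates the cone of all (t, x) with 0 ≤ t and ⟨a_i, x⟩ ≤ b_i t.
  -- Generators with t > 0 rescale to points, those with t = 0 are directions.
  obtain ⟨T, hT, hTF, hTS⟩ := exists_generators_of_forms rationals
    (S := insert (vecCons 1 0) (Set.range fun i => vecCons (b i : ℝ) (-fun j => (a i j : ℝ))))
    ((Set.finite_range _).insert _) (by
      rintro r (rfl | ⟨i, rfl⟩)
      · exact vecCons_mem (one_mem _) fun _ => zero_mem _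
      · exact vecCons_mem (ratCast_mem_rationals _)
          fun j => neg_mem (ratCast_mem_rationals _))
  have hTS' : ∀ t x, vecCons t x ∈ Submodule.span NNReal T ↔
      0 ≤ t ∧ ∀ i, (fun j => (a i j : ℝ)) ⬝ᵥ x ≤ b i * t := by
    intro t x
    rw [← hTS]
    simp [neg_dotProduct]
  have hT0 : ∀ z ∈ T, 0 ≤ vecHead z ∧
      ∀ i, (fun j => (a i j : ℝ)) ⬝ᵥ vecTail z ≤ b i * vecHead z := fun z hz => by
    rw [← hTS', Matrix.cons_head_tail]
    exact Submodule.subset_span hz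
  refine ⟨{z // z ∈ T ∧ 0 < vecHead z}, {z // z ∈ T ∧ vecHead z = 0},
    (hT.subset (Set.sep_subset _ _)).to_subtype, (hT.subset (Set.sep_subset _ _)).to_subtype,
    fun z => (vecHead z.1)⁻¹ • vecTail z.1, fun z => vecTail z.1, ?_, ?_, ?_, ?_, ?_⟩
  · exact fun z j => mul_mem (inv_mem (hTF _ z.2.1 _)) (hTF _ z.2.1 _)
  · exact fun z j => hTF _ z.2.1 _
  · intro z i
    rw [dotProduct_smul, smul_eq_mul, inv_mul_le_iff₀ z.2.2, mul_comm]
    exact (hT0 _ z.2.1).2 i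
  · intro x hx z t ht i
    have h1 := (hT0 _ z.2.1).2 i
    rw [z.2.2, mul_zero] at h1
    rw [dotProduct_add, dotProduct_smul, smul_eq_mul]
    have := mul_nonpos_of_nonneg_of_nonpos ht h1
    have := hx i
    linarith
  · intro h γ hp he x hx
    have hmem : vecCons 1 x ∈ Submodule.span NNReal T := by
      rw [hTS']; exact ⟨zero_le_one, fun i => by rw [mul_one]; exact hx i⟩
    have := dotProduct_nonneg_of_mem_span (h := vecCons γ (-h)) (fun z hz => ?_) hmem
    · simp only [Matrix.cons_dotProduct_cons, neg_dotProduct] at this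
      linarith
    · rw [Matrix.cons_dotProduct, neg_dotProduct]
      rcases (hT0 z hz).1.eq_or_lt with h0 | hpos
      · have := he ⟨z, hz, h0.symm⟩
        rw [← h0]; linarith
      · have := hp ⟨z, hz, hpos⟩
        rw [dotProduct_smul, smul_eq_mul, inv_mul_le_iff₀ hpos] at this
        linarith

/-! ### Exit times from sets of bounded width -/

/-- A nonzero linear functional is an open map, so taking interiors commutes with its preimages. -/
theorem interior_strip {d : ℕ} {a : Fin d → ℤ} (ha : a ≠ 0) (s t : ℝ) :
    interior {x : Fin d → ℝ | s ≤ (fun j => (a j : ℝ)) ⬝ᵥ x ∧ (fun j => (a j : ℝ)) ⬝ᵥ x ≤ t} =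
      {x | s < (fun j => (a j : ℝ)) ⬝ᵥ x ∧ (fun j => (a j : ℝ)) ⬝ᵥ x < t} := by
  obtain ⟨j, hj⟩ := Function.ne_iff.1 ha
  let f : StrongDual ℝ (Fin d → ℝ) :=
    LinearMap.toContinuousLinearMap (dotProductBilin ℝ ℝ (fun j => (a j : ℝ)))
  have hf : ∀ x, f x = (fun j => (a j : ℝ)) ⬝ᵥ x := fun x => rfl
  have hne : f ≠ 0 := by
    intro h0
    have h1 : f (Pi.single j 1) = 0 := by rw [h0]; rfl
    rw [hf, dotProduct_single, mul_one] at h1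
    exact hj (by exact_mod_cast h1)
  have := (f.isOpenMap_of_ne_zero hne).preimage_interior_eq_interior_preimage f.continuous
    (Set.Icc s t)
  rw [interior_Icc] at this
  exact this.symm

/-- The interior of a polyhedron with a width representation, as a finite system of strict
inequalities that is invariant under the reflection `(c, β) ↦ (-c, m - β)`. -/
theorem HasWidthRepresentation.exists_rows {d : ℕ} {L : Set (Fin d → ℝ)} {m : ℕ}
    (h : HasWidthRepresentation L m) :
    ∃ (κ : Type) (_ : Finite κ) (c : κ → Fin d → ℤ) (β : κ → ℤ) (op : κ → κ),
      (∀ r, c (op r) = -c r) ∧ (∀ r, β (op r) = m - β r) ∧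
      ∀ y, y ∈ interior L ↔ ∀ r, (fun j => (c r j : ℝ)) ⬝ᵥ y < β r := by
  obtain ⟨n, a, b, -, ha, rfl⟩ := h
  refine ⟨Fin n ⊕ Fin n, inferInstance, Sum.elim a (-a), Sum.elim b (fun i => m - b i), Sum.swap,
    ?_, ?_, fun y => ?_⟩
  · rintro (i | i) <;> simp
  · rintro (i | i) <;> simp
  · have hset : {x : Fin d → ℝ | ∀ i, (b i : ℝ) - m ≤ (fun j => (a i j : ℝ)) ⬝ᵥ x ∧
        (fun j => (a i j : ℝ)) ⬝ᵥ x ≤ b i} = ⋂ i, {x | (b i : ℝ) - m ≤ (fun j => (a i j : ℝ)) ⬝ᵥ x ∧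
        (fun j => (a i j : ℝ)) ⬝ᵥ x ≤ b i} := by
      ext x; simp
    rw [hset, interior_iInter_of_finite]
    simp only [fun i => interior_strip (ha i), Set.mem_iInter]
    have hneg : ∀ i, (fun j => -(a i j : ℝ)) ⬝ᵥ y = -((fun j => (a i j : ℝ)) ⬝ᵥ y) :=
      fun i => neg_dotProduct (fun j => (a i j : ℝ)) y
    simp only [Sum.forall, Sum.elim_inl, Sum.elim_inr, Pi.neg_apply, Int.cast_neg, Int.cast_sub,
      Int.cast_natCast, hneg]
    constructor
    · exact fun h => ⟨fun i => (h i).2, fun i => by have := (h i).1; linarith⟩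
    · exact fun h i => ⟨by have := h.2 i; linarith, h.1 i⟩

theorem exists_int_mul_dotProduct {d : ℕ} {D : ℕ} (c : Fin d → ℤ) {x : Fin d → ℝ}
    (hx : ∀ j, ∃ z : ℤ, (D : ℝ) * x j = z) :
    ∃ z : ℤ, (D : ℝ) * ((fun j => (c j : ℝ)) ⬝ᵥ x) = z := by
  choose z hz using hx
  refine ⟨∑ j, c j * z j, ?_⟩
  simp only [dotProduct, Finset.mul_sum]
  push_cast
  exact Finset.sum_congr rfl fun j _ => by rw [← hz]; ring

/-- The ray from a lattice point `p` of the interior in a lattice direction `u` leaves the interior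
at a time whose inverse is a multiple of `1 / (M * D)!`. -/
theorem exists_exit_index {d M D m : ℕ} (hD : 0 < D) (hm : m ≤ M) {κ : Type*} [Finite κ]
    {c : κ → Fin d → ℤ} {β : κ → ℤ} {op : κ → κ} (hc : ∀ r, c (op r) = -c r)
    (hβ : ∀ r, β (op r) = m - β r) {p u : Fin d → ℝ}
    (hp : ∀ r, (fun j => (c r j : ℝ)) ⬝ᵥ p < β r)
    (hpD : ∀ j, ∃ z : ℤ, (D : ℝ) * p j = z) (huD : ∀ j, ∃ z : ℤ, (D : ℝ) * u j = z) :
    ∃ k : ℕ,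
      (∀ r, ((M * D).factorial : ℝ) * ((fun j => (c r j : ℝ)) ⬝ᵥ u) ≤
        k * (β r - (fun j => (c r j : ℝ)) ⬝ᵥ p)) ∧
      (0 < k → ∃ r, ((M * D).factorial : ℝ) * ((fun j => (c r j : ℝ)) ⬝ᵥ u) =
        k * (β r - (fun j => (c r j : ℝ)) ⬝ᵥ p)) := by
  have hD' : (0 : ℝ) < D := by exact_mod_cast hD
  have hz : ∀ r, ∃ z : ℤ, ((M * D).factorial : ℝ) * ((fun j => (c r j : ℝ)) ⬝ᵥ u) =
        z * (β r - (fun j => (c r j : ℝ)) ⬝ᵥ p) := by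
    intro r
    obtain ⟨q, hq⟩ := exists_int_mul_dotProduct (c r) huD
    obtain ⟨q', hq'⟩ := exists_int_mul_dotProduct (c r) hpD
    have h1 := hp r
    have h2 := hp (op r)
    have hneg : (fun j => (c (op r) j : ℝ)) = -(fun j => (c r j : ℝ)) := by
      ext j; simp [hc]
    rw [hneg, neg_dotProduct, hβ] at h2
    push_cast at h2
    -- The slack scaled by `D` is an integer, positive by row `r` and at most `M * D` by the
    -- reflected row. Hence it divides the factorial.
    have hs : (D : ℝ) * (β r - (fun j => (c r j : ℝ)) ⬝ᵥ p) = (D * β r - q' : ℤ) := by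
      push_cast; rw [← hq']; ring
    have hpos : 0 < (D * β r - q' : ℤ) := by
      have : (0 : ℝ) < (D * β r - q' : ℤ) := by
        rw [← hs]; exact mul_pos hD' (by linarith)
      exact_mod_cast this
    have hle : (D * β r - q' : ℤ) ≤ (M * D : ℕ) := by
      have : ((D * β r - q' : ℤ) : ℝ) ≤ (M * D : ℕ) := by
        rw [← hs]; push_cast; rw [mul_comm (M : ℝ)]
        have : (m : ℝ) ≤ M := by exact_mod_cast hm
        exact mul_le_mul_of_nonneg_left (by linarith) hD'.le
      exact_mod_cast this
    obtain ⟨s, hs'⟩ := Int.eq_ofNat_of_zero_le hpos.le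
    rw [hs'] at hpos hle hs
    obtain ⟨w, hw⟩ := Nat.dvd_factorial (by exact_mod_cast hpos : 0 < s)
      (by exact_mod_cast hle : s ≤ M * D)
    refine ⟨w * q, ?_⟩
    rw [hw]
    refine mul_left_cancel₀ hD'.ne' ?_
    push_cast at hs ⊢
    calc (D : ℝ) * (s * w * ((fun j => (c r j : ℝ)) ⬝ᵥ u))
        = s * w * (D * ((fun j => (c r j : ℝ)) ⬝ᵥ u)) := by ring
      _ = w * q * (D * (β r - (fun j => (c r j : ℝ)) ⬝ᵥ p)) := by rw [hq, hs]; ring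
      _ = _ := by ring
  choose z hz using hz
  -- The row with the largest quotient is hit first. If no quotient is positive the ray never
  -- leaves, which is encoded by 0.
  by_cases hex : ∃ r, 0 < z r
  · obtain ⟨r₀, hr₀⟩ := hex
    have : Nonempty κ := ⟨r₀⟩
    obtain ⟨r₁, hr₁⟩ := Finite.exists_max z
    obtain ⟨k, hk⟩ := Int.eq_ofNat_of_zero_le (hr₀.le.trans (hr₁ r₀))
    refine ⟨k, fun r => ?_, fun _ => ⟨r₁, ?_⟩⟩
    · rw [hz]
      have : (z r : ℝ) ≤ k := by
        have := hr₁ r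
        rw [hk] at this
        exact_mod_cast this
      exact mul_le_mul_of_nonneg_right this (sub_nonneg.2 (hp r).le)
    · rw [hz, hk]; simp
  · push Not at hex
    refine ⟨0, fun r => ?_, fun h => absurd h (lt_irrefl _)⟩
    rw [hz, Nat.cast_zero, zero_mul]
    exact mul_nonpos_of_nonpos_of_nonneg (by exact_mod_cast hex r) (sub_nonneg.2 (hp r).le)

/-! ### Finite domination, exit points and valid inequalities -/

/-- Dickson's lemma: a family of tuples of naturals is dominated from below by a finite part. -/
theorem exists_finite_dominating {α ι : Type*} [Finite ι] (s : Set α) (f : α → ι → ℕ) :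
    ∃ t ⊆ s, t.Finite ∧ ∀ a ∈ s, ∃ b ∈ t, f b ≤ f a := by
  have hpwo : (f '' s).IsPWO := Set.isPWO_of_wellQuasiOrderedLE _
  -- Minimal elements form an antichain, and antichains of a well-quasi-order are finite.
  have hfin : {x | Minimal (· ∈ f '' s) x}.Finite :=
    (setOfPred_minimal_antichain _).finite_of_partiallyWellOrderedOn
      (hpwo.mono fun x hx => hx.prop)
  obtain ⟨t, hts, ht, hmin⟩ := (Set.exists_subset_image_finite_and (f := f) (s := s)
    (p := fun t => ∀ x ∈ f '' s, ∃ b ∈ t, b ≤ x)).1 ⟨_, fun x hx => hx.prop, hfin, fun x hx => by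
      obtain ⟨b, hba, hb⟩ := hpwo.exists_le_minimal hx
      exact ⟨b, hb, hba⟩⟩
  refine ⟨t, hts, ht, fun a ha => ?_⟩
  obtain ⟨_, ⟨b, hb, rfl⟩, hba⟩ := hmin _ (Set.mem_image_of_mem f ha)
  exact ⟨b, hb, hba⟩

/-- For points `p` and directions `e`, the points of `p` outside the set with index set `W` and the
points where the segments between `p`s and the rays from `p`s in directions `e` leave this set,
as encoded by the reciprocal exit times `k / N`. -/
def exitPoints {d : ℕ} {I J : Type} (p : I → Fin d → ℝ) (e : J → Fin d → ℝ) (N : ℝ) (W : Set I)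
    (k : I → I ⊕ J → ℕ) : Set (Fin d → ℝ) :=
  {y | ∃ i ∉ W, y = p i} ∪ {y | ∃ i ∈ W, ∃ j, 0 < k i (.inr j) ∧ y = p i + (N / k i (.inr j)) • e j} ∪
    {y | ∃ i ∈ W, ∃ i' ∉ W, 0 < k i (.inl i') ∧ y = p i + (N / k i (.inl i')) • (p i' - p i)}

/-- `k / N` bounds the reciprocal exit times of the open set `O` from above. -/
def BoundsExit {d : ℕ} {I J : Type} (p : I → Fin d → ℝ) (e : J → Fin d → ℝ) (N : ℝ)
    (k : I → I ⊕ J → ℕ) (O : Set (Fin d → ℝ)) : Prop :=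
  ∀ x ∉ O, ∃ (c : Fin d → ℝ) (β : ℝ), β ≤ c ⬝ᵥ x ∧ ∀ i, p i ∈ O → c ⬝ᵥ p i < β ∧
    ∀ u, N * (c ⬝ᵥ (Sum.elim (fun i' => p i' - p i) e u)) ≤ k i u * (β - c ⬝ᵥ p i)

theorem exitPoints_finite {d : ℕ} {I J : Type} [Finite I] [Finite J] (p : I → Fin d → ℝ)
    (e : J → Fin d → ℝ) (N : ℝ) (W : Set I) (k : I → I ⊕ J → ℕ) :
    (exitPoints p e N W k).Finite := by
  refine (Set.Finite.union ?_ ?_).union ?_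
  · refine (Set.finite_range p).subset ?_
    rintro _ ⟨i, -, rfl⟩; exact ⟨i, rfl⟩
  · refine (Set.finite_range fun x : I × J => p x.1 + (N / k x.1 (.inr x.2)) • e x.2).subset ?_
    rintro _ ⟨i, -, j, -, rfl⟩; exact ⟨(i, j), rfl⟩
  · refine (Set.finite_range
      fun x : I × I => p x.1 + (N / k x.1 (.inl x.2)) • (p x.2 - p x.1)).subset ?_
    rintro _ ⟨i, -, j, -, -, rfl⟩; exact ⟨(i, j), rfl⟩

theorem exitPoints_mem {d : ℕ} {I J : Type} {F : Subfield ℝ} {p : I → Fin d → ℝ}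
    {e : J → Fin d → ℝ} {N : ℝ} {W : Set I} {k : I → I ⊕ J → ℕ} (hp : ∀ i j, p i j ∈ F)
    (he : ∀ i j, e i j ∈ F) (hN : N ∈ F) : ∀ y ∈ exitPoints p e N W k, ∀ j, y j ∈ F := by
  rintro _ ((⟨i, -, rfl⟩ | ⟨i, -, i', -, rfl⟩) | ⟨i, -, i', -, -, rfl⟩) j
  · exact hp i j
  · exact add_mem (hp i j) (mul_mem (div_mem hN (natCast_mem F _)) (he i' j))
  · exact add_mem (hp i j)
      (mul_mem (div_mem hN (natCast_mem F _)) (sub_mem (hp i' j) (hp i j)))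

/-- An inequality valid on the directions and on the exit points is valid on `P \ O`. -/
theorem valid_of_valid_on_exitPoints {d : ℕ} {I J : Type} [Finite I] {p : I → Fin d → ℝ}
    {e : J → Fin d → ℝ} {N : ℝ} (hN : 0 < N) {k k' : I → I ⊕ J → ℕ} {P O : Set (Fin d → ℝ)}
    (hP : ∀ (h : Fin d → ℝ) (γ : ℝ), (∀ i, h ⬝ᵥ p i ≤ γ) → (∀ j, h ⬝ᵥ e j ≤ 0) →
        ∀ x ∈ P, h ⬝ᵥ x ≤ γ)
    (hO : BoundsExit p e N k O) (hk : ∀ i u, k i u ≤ k' i u)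
    {h : Fin d → ℝ} {γ : ℝ} (hγ : ∀ y ∈ exitPoints p e N {i | p i ∈ O} k', h ⬝ᵥ y ≤ γ)
    (he : ∀ j, h ⬝ᵥ e j ≤ 0) : ∀ x ∈ P \ O, h ⬝ᵥ x ≤ γ := by
  rintro x ⟨hxP, hxO⟩
  obtain ⟨c, β, hx, hc⟩ := hO x hxO
  -- `θ` is the least nonnegative multiplier for which `h + θ • c ≤ γ + θ * β` holds at every `p i`
  -- in `O`. If it holds on all of `P`, then `β ≤ c ⬝ᵥ x` gives the claim at `x`.
  obtain ⟨θ, hθ, hmax⟩ := Set.exists_max_image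
    (insert 0 ((fun i => (h ⬝ᵥ p i - γ) / (β - c ⬝ᵥ p i)) '' {i | p i ∈ O})) id
    ((Set.toFinite _).insert 0) ⟨0, Set.mem_insert _ _⟩
  have hθ0 : 0 ≤ θ := hmax 0 (Set.mem_insert _ _)
  suffices hsuff : (h + θ • c) ⬝ᵥ x ≤ γ + θ * β by
    rw [add_dotProduct, smul_dotProduct, smul_eq_mul] at hsuff
    have := mul_le_mul_of_nonneg_left hx hθ0
    linarith
  have hbound : ∀ i, p i ∈ O → ∀ u,
      N * (c ⬝ᵥ (Sum.elim (fun i' => p i' - p i) e u)) ≤ k' i u * (β - c ⬝ᵥ p i) := by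
    intro i hi u
    refine ((hc i hi).2 u).trans (mul_le_mul_of_nonneg_right ?_ (sub_nonneg.2 (hc i hi).1.le))
    exact_mod_cast hk i u
  -- if `c` increases along `u`, then the exit index is positive
  have hexit : ∀ i, p i ∈ O → ∀ u, 0 < c ⬝ᵥ (Sum.elim (fun i' => p i' - p i) e u) → 0 < k' i u ∧
      N / k' i u * (c ⬝ᵥ (Sum.elim (fun i' => p i' - p i) e u)) ≤ β - c ⬝ᵥ p i := by
    intro i hi u hu
    have hk' : 0 < k' i u := by
      by_contra h0
      have h1 := hbound i hi u
      rw [Nat.eq_zero_of_not_pos h0, Nat.cast_zero, zero_mul] at h1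
      exact absurd (mul_pos hN hu) (not_lt.2 h1)
    have : (0 : ℝ) < k' i u := by exact_mod_cast hk'
    refine ⟨hk', ?_⟩
    rw [div_mul_eq_mul_div, div_le_iff₀ this, mul_comm _ (k' i u : ℝ)]
    exact hbound i hi u
  refine hP _ _ (fun i => ?_) (fun j => ?_) x hxP <;>
    rw [add_dotProduct, smul_dotProduct, smul_eq_mul]
  · by_cases hi : p i ∈ O
    · have hs := sub_pos.2 (hc i hi).1
      have := hmax _ (Set.mem_insert_of_mem _ ⟨i, hi, rfl⟩)
      simp only [id] at this
      rw [div_le_iff₀ hs] at this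
      linarith
    · have hi' := hγ _ (Or.inl (Or.inl ⟨i, hi, rfl⟩))
      rcases le_or_gt (c ⬝ᵥ p i) β with hle | hlt
      · have := mul_le_mul_of_nonneg_left hle hθ0
        linarith
      -- When `θ` is attained at `i₀`, the combined inequality is tight at `p i₀`. It holds at the
      -- exit point toward `p i`, where `h ≤ γ` and `c ≤ β`, so the combined form does not increase
      -- in that direction and it holds at `p i`. The directions `e j` are treated alike.
      rcases hθ with rfl | ⟨i₀, hi₀, rfl⟩
      · linarith
      have hs := sub_pos.2 (hc i₀ hi₀).1
      obtain ⟨hk₀, hle⟩ := hexit i₀ hi₀ (.inl i) (by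
        rw [Sum.elim_inl, dotProduct_sub]; linarith)
      have hval := hγ _ (Or.inr ⟨i₀, hi₀, i, hi, hk₀, rfl⟩)
      rw [Sum.elim_inl] at hle
      simp only [dotProduct_add, dotProduct_smul, dotProduct_sub, smul_eq_mul] at hval hle hθ0 ⊢
      have hτ : 0 < N / k' i₀ (.inl i) := div_pos hN (by exact_mod_cast hk₀)
      generalize N / (k' i₀ (.inl i) : ℝ) = τ at hval hle hτ
      set θ := (h ⬝ᵥ p i₀ - γ) / (β - c ⬝ᵥ p i₀) with hθdef
      have hθs : θ * (β - c ⬝ᵥ p i₀) = h ⬝ᵥ p i₀ - γ := div_mul_cancel₀ _ hs.ne'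
      have h1 := mul_le_mul_of_nonneg_left hle hθ0
      have h2 : τ * (h ⬝ᵥ p i + θ * c ⬝ᵥ p i - (γ + θ * β)) ≤ 0 := by
        have h3 : h ⬝ᵥ p i₀ = θ * (β - c ⬝ᵥ p i₀) + γ := by linarith
        rw [h3] at hval
        linarith
      have := nonpos_of_mul_nonpos_right h2 hτ
      linarith
  · have hj := he j
    rcases le_or_gt (c ⬝ᵥ e j) 0 with hle | hlt
    · have := mul_nonpos_of_nonneg_of_nonpos hθ0 hle
      linarith
    rcases hθ with rfl | ⟨i₀, hi₀, rfl⟩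
    · linarith
    have hs := sub_pos.2 (hc i₀ hi₀).1
    obtain ⟨hk₀, hle⟩ := hexit i₀ hi₀ (.inr j) hlt
    have hval := hγ _ (Or.inl (Or.inr ⟨i₀, hi₀, j, hk₀, rfl⟩))
    rw [Sum.elim_inr] at hle
    simp only [dotProduct_add, dotProduct_smul, smul_eq_mul] at hval hle hθ0 ⊢
    have hτ : 0 < N / k' i₀ (.inr j) := div_pos hN (by exact_mod_cast hk₀)
    generalize N / (k' i₀ (.inr j) : ℝ) = τ at hval hle hτ
    set θ := (h ⬝ᵥ p i₀ - γ) / (β - c ⬝ᵥ p i₀) with hθdef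
    have hθs : θ * (β - c ⬝ᵥ p i₀) = h ⬝ᵥ p i₀ - γ := div_mul_cancel₀ _ hs.ne'
    have h1 := mul_le_mul_of_nonneg_left hle hθ0
    have h2 : τ * (h ⬝ᵥ e j + θ * c ⬝ᵥ e j) ≤ 0 := by linarith
    exact nonpos_of_mul_nonpos_right h2 hτ

/-! ### Exit points describe `R L P` -/

/-- A convex set that contains the finite set `S` and recedes along the finitely many directions `e`
contains the solution set of finitely many inequalities valid on `S` and on `e`. -/
theorem exists_outer_description {d : ℕ} {J : Type} [Finite J] (F : Subfield ℝ)
    {S C : Set (Fin d → ℝ)} {e : J → Fin d → ℝ} (hS : S.Finite) (hSF : ∀ y ∈ S, ∀ j, y j ∈ F)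
    (heF : ∀ i j, e i j ∈ F) (hC : Convex ℝ C) (hSC : S ⊆ C)
    (heC : ∀ x ∈ C, ∀ j, ∀ t : ℝ, 0 ≤ t → x + t • e j ∈ C) :
    ∃ U : Set (Fin (d + 1) → ℝ), U.Finite ∧ (∀ r ∈ U, ∀ j, r j ∈ F) ∧
      (∀ r ∈ U, (∀ y ∈ S, 0 ≤ vecHead r + vecTail r ⬝ᵥ y) ∧ ∀ j, 0 ≤ vecTail r ⬝ᵥ e j) ∧
      ∀ x, (∀ r ∈ U, 0 ≤ vecHead r + vecTail r ⬝ᵥ x) → x ∈ C := by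
  obtain ⟨U, hU, hUF, hUT⟩ := exists_forms_of_generators F
    (T := vecCons 1 '' S ∪ Set.range fun j => vecCons 0 (e j))
    ((hS.image _).union (Set.finite_range _)) (by
      rintro r (⟨y, hy, rfl⟩ | ⟨j, rfl⟩)
      · exact vecCons_mem (one_mem _) (hSF y hy)
      · exact vecCons_mem (zero_mem _) (heF j))
  refine ⟨U, hU, hUF, fun r hr => ⟨fun y hy => ?_, fun j => ?_⟩, fun x hx => ?_⟩
  · have := (hUT _).2 (Submodule.subset_span (Or.inl ⟨y, hy, rfl⟩)) r hr
    simpa using this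
  · have := (hUT _).2 (Submodule.subset_span (Or.inr ⟨j, rfl⟩)) r hr
    simpa using this
  · have hmem := (hUT (vecCons 1 x)).1 fun r hr => by simpa using hx r hr
    rw [Submodule.span_union, Submodule.mem_sup] at hmem
    obtain ⟨y, hy, z, hz, hyz⟩ := hmem
    -- In the homogenized cone the part generated by `S` is zero or a positive multiple of a point
    -- of `C`; zero is excluded later because the head of the sum is 1.
    have hy' : y = 0 ∨ 0 < vecHead y ∧ (vecHead y)⁻¹ • vecTail y ∈ C := by
      clear hyz
      induction hy using Submodule.span_induction with
      | mem y hy =>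
        obtain ⟨w, hw, rfl⟩ := hy
        right; simpa using hSC hw
      | zero => exact Or.inl rfl
      | add y y' _ _ ih ih' =>
        rcases ih with rfl | ⟨h1, h2⟩
        · rw [zero_add]; exact ih'
        rcases ih' with rfl | ⟨h3, h4⟩
        · rw [add_zero]; exact Or.inr ⟨h1, h2⟩
        · have hhead : vecHead (y + y') = vecHead y + vecHead y' := rfl
          have htail : vecTail (y + y') = vecTail y + vecTail y' := rfl
          refine Or.inr ⟨by rw [hhead]; exact add_pos h1 h3, ?_⟩
          rw [hhead, htail]
          have hpos := add_pos h1 h3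
          have := hC h2 h4 (div_pos h1 hpos).le (div_pos h3 hpos).le (by
            rw [← add_div, div_self hpos.ne'])
          convert this using 1
          rw [smul_smul, smul_smul, smul_add]
          congr 2 <;> field_simp
      | smul a y _ ih =>
        rcases ih with rfl | ⟨h1, h2⟩
        · left; simp
        rcases eq_or_ne a 0 with rfl | ha
        · left; simp
        have ha' : (0 : ℝ) < a := by exact_mod_cast pos_iff_ne_zero.2 ha
        have hhead : vecHead (a • y) = a * vecHead y := rfl
        have htail : vecTail (a • y) = (a : ℝ) • vecTail y := rfl
        refine Or.inr ⟨by rw [hhead]; exact mul_pos ha' h1, ?_⟩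
        rw [hhead, htail, smul_smul]
        convert h2 using 2
        field_simp
    have hz' : vecHead z = 0 ∧ ∀ x ∈ C, ∀ t : ℝ, 0 ≤ t → x + t • vecTail z ∈ C := by
      clear hyz
      induction hz using Submodule.span_induction with
      | mem z hz =>
        obtain ⟨j, rfl⟩ := hz
        refine ⟨by simp, fun x hx t ht => ?_⟩
        simpa using heC x hx j t ht
      | zero => exact ⟨rfl, fun x hx t _ => by convert hx; ext j; simp [vecTail]⟩
      | add z z' _ _ ih ih' =>
        have hhead : vecHead (z + z') = vecHead z + vecHead z' := rfl
        have htail : vecTail (z + z') = vecTail z + vecTail z' := rfl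
        refine ⟨by rw [hhead, ih.1, ih'.1, add_zero], fun x hx t ht => ?_⟩
        rw [htail, smul_add, ← add_assoc]
        exact ih'.2 _ (ih.2 x hx t ht) t ht
      | smul a z _ ih =>
        have hhead : vecHead (a • z) = a * vecHead z := rfl
        have htail : vecTail (a • z) = (a : ℝ) • vecTail z := rfl
        refine ⟨by rw [hhead, ih.1, mul_zero], fun x hx t ht => ?_⟩
        rw [htail, smul_smul]
        exact ih.2 x hx _ (mul_nonneg ht a.2)
    have hhead : vecHead y + vecHead z = 1 := by
      have := congrArg vecHead hyz
      simpa using this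
    have htail : vecTail y + vecTail z = x := by
      have := congrArg vecTail hyz
      simpa using this
    rw [hz'.1, add_zero] at hhead
    rcases hy' with rfl | ⟨-, hy'⟩
    · exact absurd hhead (by simp [vecHead])
    · rw [hhead, inv_one, one_smul] at hy'
      rw [← htail]
      simpa using hz'.2 _ hy' 1 zero_le_one

/-- Collects the indices of `exists_exit_index` over all base points and directions. A positive
index is attained by some row, so the point it encodes lies on the boundary of a strict inequality
and is really outside the interior. -/
theorem HasWidthRepresentation.exists_exit_table {d M D m : ℕ} (hD : 0 < D) (hm : m ≤ M)
    {L : Set (Fin d → ℝ)} (hL : HasWidthRepresentation L m) {I J : Type} {p : I → Fin d → ℝ}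
    {e : J → Fin d → ℝ} (hpD : ∀ i j, ∃ z : ℤ, (D : ℝ) * p i j = z)
    (heD : ∀ i j, ∃ z : ℤ, (D : ℝ) * e i j = z) :
    ∃ k : I → I ⊕ J → ℕ, BoundsExit p e (M * D).factorial k (interior L) ∧
      ∀ i, p i ∈ interior L → ∀ u, 0 < k i u → p i + (((M * D).factorial : ℝ) / k i u) •
        Sum.elim (fun i' => p i' - p i) e u ∉ interior L := by
  obtain ⟨κ, _, c, β, op, hc, hβ, hint⟩ := hL.exists_rows
  have huD : ∀ i u j, ∃ z : ℤ, (D : ℝ) * Sum.elim (fun i' => p i' - p i) e u j = z := by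
    rintro i (i' | i') j
    · obtain ⟨z, hz⟩ := hpD i j
      obtain ⟨z', hz'⟩ := hpD i' j
      refine ⟨z' - z, ?_⟩
      push_cast
      rw [← hz, ← hz', Sum.elim_inl, Pi.sub_apply, mul_sub]
    · exact heD i' j
  have key : ∀ i u, ∃ k : ℕ, p i ∈ interior L →
      (∀ r, ((M * D).factorial : ℝ) *
        ((fun j => (c r j : ℝ)) ⬝ᵥ Sum.elim (fun i' => p i' - p i) e u) ≤
        k * (β r - (fun j => (c r j : ℝ)) ⬝ᵥ p i)) ∧
      (0 < k → ∃ r, ((M * D).factorial : ℝ) *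
        ((fun j => (c r j : ℝ)) ⬝ᵥ Sum.elim (fun i' => p i' - p i) e u) =
        k * (β r - (fun j => (c r j : ℝ)) ⬝ᵥ p i)) := by
    intro i u
    by_cases hi : p i ∈ interior L
    · obtain ⟨k, hk⟩ := exists_exit_index hD hm hc hβ ((hint _).1 hi) (hpD i) (huD i u)
      exact ⟨k, fun _ => hk⟩
    · exact ⟨0, fun h => absurd h hi⟩
  choose k hk using key
  refine ⟨k, fun x hx => ?_, fun i hi u hu hmem => ?_⟩
  · rw [hint] at hx
    push Not at hx
    obtain ⟨r, hr⟩ := hx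
    exact ⟨_, _, hr, fun i hi => ⟨(hint _).1 hi r, fun u => (hk i u hi).1 r⟩⟩
  · obtain ⟨r, hr⟩ := (hk i u hi).2 hu
    have hu' : (k i u : ℝ) ≠ 0 := by exact_mod_cast hu.ne'
    have := (hint _).1 hmem r
    rw [dotProduct_add, dotProduct_smul, smul_eq_mul, div_mul_eq_mul_div, hr,
      mul_div_cancel_left₀ _ hu'] at this
    linarith

/-- The complement of the interior is left only for bounded times. -/
theorem HasWidthRepresentation.exists_ge_notMem_interior {d m : ℕ} {L : Set (Fin d → ℝ)}
    (hL : HasWidthRepresentation L m) {y : Fin d → ℝ} (hy : y ∉ interior L) (u : Fin d → ℝ)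
    (t : ℝ) (ht : 0 ≤ t) : ∃ s, t ≤ s ∧ y + s • u ∉ interior L := by
  obtain ⟨κ, _, c, β, op, hc, hβ, hint⟩ := hL.exists_rows
  simp only [hint, dotProduct_add, dotProduct_smul, smul_eq_mul] at hy ⊢
  push Not at hy ⊢
  obtain ⟨r, hr⟩ := hy
  rcases le_or_gt 0 ((fun j => (c r j : ℝ)) ⬝ᵥ u) with hle | hlt
  · exact ⟨t, le_rfl, r, by have := mul_nonneg ht hle; linarith⟩
  · have hneg : (fun j => (c (op r) j : ℝ)) = -(fun j => (c r j : ℝ)) := by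
      ext j; simp [hc]
    have hpos := neg_pos.2 hlt
    -- Moving along `u` relaxes row `r` but tightens its reflection, which is violated from this
    -- time on.
    refine ⟨max t ((β (op r) + (fun j => (c r j : ℝ)) ⬝ᵥ y) / -((fun j => (c r j : ℝ)) ⬝ᵥ u)),
      le_max_left _ _, op r, ?_⟩
    have := (div_le_iff₀ hpos).1 (le_max_right t
      ((β (op r) + (fun j => (c r j : ℝ)) ⬝ᵥ y) / -((fun j => (c r j : ℝ)) ⬝ᵥ u)))
    rw [hneg, neg_dotProduct, neg_dotProduct]
    linarith

/-- The row violated at `p i'` forces N ≤ k, so the exit time toward `p i'` is at most 1 and the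
exit point stays on the segment inside `P`. -/
theorem exitPoints_subset {d : ℕ} {I J : Type} {p : I → Fin d → ℝ}
    {e : J → Fin d → ℝ} {N : ℝ} (hN : 0 < N) {k : I → I ⊕ J → ℕ} {P O : Set (Fin d → ℝ)}
    (hconv : Convex ℝ P) (hp : ∀ i, p i ∈ P) (he : ∀ x ∈ P, ∀ j, ∀ t : ℝ, 0 ≤ t → x + t • e j ∈ P)
    (hO : BoundsExit p e N k O)
    (hexit : ∀ i, p i ∈ O → ∀ u, 0 < k i u →
      p i + (N / k i u) • Sum.elim (fun i' => p i' - p i) e u ∉ O) :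
    exitPoints p e N {i | p i ∈ O} k ⊆ P \ O := by
  rintro _ ((⟨i, hi, rfl⟩ | ⟨i, hi, j, hk, rfl⟩) | ⟨i, hi, i', hi', hk, rfl⟩)
  · exact ⟨hp i, hi⟩
  · exact ⟨he _ (hp i) _ _ (by positivity), hexit i hi _ hk⟩
  · refine ⟨?_, hexit i hi _ hk⟩
    refine hconv.add_smul_sub_mem (hp i) (hp i') ⟨by positivity, ?_⟩
    obtain ⟨c, β, hx, hc⟩ := hO (p i') hi'
    have hk' : (0 : ℝ) < k i (.inl i') := by exact_mod_cast hk
    obtain ⟨h1, h2⟩ := hc i hi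
    have h3 := h2 (.inl i')
    rw [Sum.elim_inl, dotProduct_sub] at h3
    rw [div_le_one hk']
    refine le_of_mul_le_mul_right (h3.trans ?_) (by linarith : 0 < c ⬝ᵥ p i' - c ⬝ᵥ p i)
    exact mul_le_mul_of_nonneg_left (by linarith) hk'.le

/-- The translate of a point of `P \ interior L` may fall into the interior, but it lies on a
segment from that point to one further along the ray and outside the interior again; convexity does
the rest. -/
theorem R_add_smul_mem {d m : ℕ} {L P : Set (Fin d → ℝ)} (hL : HasWidthRepresentation L m)
    {u : Fin d → ℝ} (hu : ∀ x ∈ P, ∀ t : ℝ, 0 ≤ t → x + t • u ∈ P) :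
    ∀ x ∈ R L P, ∀ t : ℝ, 0 ≤ t → x + t • u ∈ R L P := by
  intro x hx t ht
  have hconv : Convex ℝ ((fun z => z + t • u) ⁻¹' R L P) :=
    (convex_convexHull ℝ _).translate_preimage_left _
  refine convexHull_min ?_ hconv hx
  rintro y ⟨hyP, hyL⟩
  obtain ⟨s, hts, hs⟩ := hL.exists_ge_notMem_interior hyL u t ht
  have hy : y ∈ R L P := subset_convexHull _ _ ⟨hyP, hyL⟩
  have hys : y + s • u ∈ R L P := subset_convexHull _ _ ⟨hu _ hyP _ (ht.trans hts), hs⟩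
  rcases ht.eq_or_lt with rfl | hpos
  · simpa using hy
  · have hs0 := hpos.trans_le hts
    have := (convex_convexHull ℝ _).add_smul_mem hy hys
      (⟨by positivity, (div_le_one hs0).2 hts⟩ : t / s ∈ Set.Icc (0 : ℝ) 1)
    rwa [smul_smul, div_mul_cancel₀ _ hs0.ne'] at this

/-! ### Rational halfspaces and finite intersections -/

/-- The linear part may vanish. A true constant inequality becomes the empty family, and a false one
becomes two disjoint halfspaces, which needs a nonzero vector and so `0 < d`. -/
theorem exists_halfspaces {d : ℕ} (hd : 0 < d) {a : Fin d → ℝ} {b : ℝ}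
    (ha : ∀ j, a j ∈ rationals) (hb : b ∈ rationals) :
    ∃ ℋ : Set (Set (Fin d → ℝ)), ℋ.Finite ∧ (∀ H ∈ ℋ, IsRationalHalfspace H) ∧
      ⋂₀ ℋ = {x | 0 ≤ b + a ⬝ᵥ x} := by
  choose a' ha' using fun j => mem_rationals.1 (ha j)
  obtain ⟨b', rfl⟩ := mem_rationals.1 hb
  obtain rfl : a = fun j => (a' j : ℝ) := funext fun j => (ha' j).symm
  have hneg : ∀ x, (fun j => ((-a') j : ℝ)) ⬝ᵥ x = -((fun j => (a' j : ℝ)) ⬝ᵥ x) := fun x => by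
    rw [← neg_dotProduct]; congr 1; ext j; simp
  by_cases h0 : a' = 0
  · subst h0
    rcases le_or_gt 0 b' with hb0 | hb0
    · refine ⟨∅, Set.finite_empty, by simp, ?_⟩
      have : (0 : ℝ) ≤ b' := by exact_mod_cast hb0
      ext x; simp [dotProduct, this]
    · let s : Fin d → ℚ := Pi.single ⟨0, hd⟩ 1
      have hs : s ≠ 0 := by simp [s]
      refine ⟨{{x | (fun j => (s j : ℝ)) ⬝ᵥ x ≤ (0 : ℚ)}, {x | (fun j => ((-s) j : ℝ)) ⬝ᵥ x ≤ (-1 : ℚ)}},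
        by simp, ?_, ?_⟩
      · rintro H (rfl | rfl)
        · exact ⟨s, 0, hs, rfl⟩
        · exact ⟨-s, -1, neg_ne_zero.2 hs, rfl⟩
      · have : (b' : ℝ) < 0 := by exact_mod_cast hb0
        ext x
        have hn : (fun j => ((-s) j : ℝ)) ⬝ᵥ x = -((fun j => (s j : ℝ)) ⬝ᵥ x) := by
          rw [← neg_dotProduct]; congr 1; ext j; simp
        have hz : (fun j => (((0 : Fin d → ℚ) j : ℚ) : ℝ)) ⬝ᵥ x = 0 := by simp [dotProduct]
        simp only [Set.sInter_insert, Set.sInter_singleton, Set.mem_inter_iff, Set.mem_ofPred_eq, hn,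
          hz, add_zero]
        push_cast
        constructor
        · rintro ⟨h1, h2⟩; linarith
        · intro h; linarith
  · refine ⟨{{x | (fun j => ((-a') j : ℝ)) ⬝ᵥ x ≤ b'}}, by simp, ?_, ?_⟩
    · rintro H rfl
      exact ⟨-a', b', neg_ne_zero.2 h0, rfl⟩
    · ext x
      simp only [Set.sInter_singleton, Set.mem_ofPred_eq, hneg]
      constructor <;> intro h <;> linarith

theorem exists_halfspaces_of_forms {d : ℕ} (hd : 0 < d) {U : Set (Fin (d + 1) → ℝ)}
    (hU : U.Finite) (hUF : ∀ r ∈ U, ∀ j, r j ∈ rationals) :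
    ∃ ℋ : Set (Set (Fin d → ℝ)), ℋ.Finite ∧ (∀ H ∈ ℋ, IsRationalHalfspace H) ∧
      ⋂₀ ℋ = {x | ∀ r ∈ U, 0 ≤ vecHead r + vecTail r ⬝ᵥ x} := by
  induction U, hU using Set.Finite.induction_on with
  | empty => exact ⟨∅, Set.finite_empty, by simp, by simp⟩
  | @insert r U _ _ ih =>
    obtain ⟨ℋ, hfin, hℋ, heq⟩ := ih fun r hr => hUF r (Set.mem_insert_of_mem _ hr)
    obtain ⟨ℋ', hfin', hℋ', heq'⟩ := exists_halfspaces hd (a := vecTail r) (b := vecHead r)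
      (fun j => hUF r (Set.mem_insert _ _) _) (hUF r (Set.mem_insert _ _) _)
    refine ⟨ℋ' ∪ ℋ, hfin'.union hfin, ?_, ?_⟩
    · rintro H (hH | hH)
      exacts [hℋ' H hH, hℋ H hH]
    · rw [Set.sInter_union, heq, heq']
      ext x
      simp

theorem IsRationalHalfspace.isClosedHalfspace {d : ℕ} {H : Set (Fin d → ℝ)}
    (hH : IsRationalHalfspace H) : IsClosedHalfspace H := by
  obtain ⟨a, b, ha, rfl⟩ := hH
  refine ⟨_, _, fun h => ha ?_, rfl⟩
  ext j
  have := congrFun h j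
  simpa using this

/-- Rational polyhedra are closed under finite intersections. -/
theorem IsRationalPolyhedron.inter {d : ℕ} {P Q : Set (Fin d → ℝ)} (hP : IsRationalPolyhedron P)
    (hQ : IsRationalPolyhedron Q) : IsRationalPolyhedron (P ∩ Q) := by
  obtain ⟨n, a, b, rfl⟩ := hP
  obtain ⟨n', a', b', rfl⟩ := hQ
  refine ⟨n + n', Fin.append a a', Fin.append b b', ?_⟩
  ext x
  simp only [Set.mem_inter_iff, Set.mem_ofPred_eq]
  constructor
  · rintro ⟨h1, h2⟩ i
    refine Fin.addCases (fun i => ?_) (fun i => ?_) i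
    · simpa using h1 i
    · simpa using h2 i
  · intro h
    exact ⟨fun i => by simpa using h (Fin.castAdd n' i), fun i => by simpa using h (Fin.natAdd n i)⟩

theorem isRationalPolyhedron_univ {d : ℕ} : IsRationalPolyhedron (Set.univ : Set (Fin d → ℝ)) :=
  ⟨0, Fin.elim0, Fin.elim0, by ext x; simp⟩

theorem IsRationalHalfspace.isRationalPolyhedron {d : ℕ} {H : Set (Fin d → ℝ)}
    (hH : IsRationalHalfspace H) : IsRationalPolyhedron H := by
  obtain ⟨a, b, -, rfl⟩ := hH
  exact ⟨1, fun _ => a, fun _ => b, by ext x; simp⟩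

theorem isRationalPolyhedron_sInter {d : ℕ} {ℋ : Set (Set (Fin d → ℝ))} (hfin : ℋ.Finite)
    (hℋ : ∀ H ∈ ℋ, IsRationalHalfspace H) : IsRationalPolyhedron (⋂₀ ℋ) := by
  induction ℋ, hfin using Set.Finite.induction_on with
  | empty => rw [Set.sInter_empty]; exact isRationalPolyhedron_univ
  | insert _ _ ih =>
    rw [Set.sInter_insert]
    exact (hℋ _ (Set.mem_insert _ _)).isRationalPolyhedron.inter
      (ih fun H hH => hℋ H (Set.mem_insert_of_mem _ hH))

/-! ### Finitely many cuts for families of bounded width -/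

/-- An infimum of naturals in `ℕ∞` that is at most `M` has a witness at most `M`; otherwise it would
be at least `M + 1`. -/
theorem maxFacetWidth_le_iff {d M : ℕ} {L : Set (Fin d → ℝ)} :
    maxFacetWidth L ≤ M ↔ L ≠ Set.univ ∧ IsLinearSpace (recessionCone L) ∧
      ∃ m ≤ M, 1 ≤ m ∧ HasWidthRepresentation L m := by
  unfold maxFacetWidth
  split_ifs with h
  · simp only [ne_eq, h.1, not_false_eq_true, h.2, true_and]
    constructor
    · intro hle
      by_contra! hcon
      have : ((M + 1 : ℕ) : ℕ∞) ≤ ⨅ (m : ℕ) (_ : 1 ≤ m ∧ HasWidthRepresentation L m), (m : ℕ∞) := by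
        refine le_iInf₂ fun m hm => ?_
        by_contra hlt
        have : m ≤ M := by
          have : m < M + 1 := by exact_mod_cast not_le.1 hlt
          omega
        exact hcon m this hm.1 hm.2
      have := this.trans hle
      have : M + 1 ≤ M := by exact_mod_cast this
      omega
    · rintro ⟨m, hmM, hm⟩
      exact (iInf₂_le m hm).trans (by exact_mod_cast hmM)
  · simp only [top_le_iff, ENat.natCast_ne_top, false_iff]
    tauto

/-- Bounded max-facet-width makes the closure the intersection of finitely many rational cuts. -/
theorem exists_finite_rational_cuts {d : ℕ} {P : Set (Fin d → ℝ)} (hP : IsRationalPolyhedron P)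
    {𝓛 : Set (Set (Fin d → ℝ))} {M : ℕ} (h𝓛 : ∀ L ∈ 𝓛, ∃ m ≤ M, HasWidthRepresentation L m) :
    ∃ ℋ : Set (Set (Fin d → ℝ)), ℋ.Finite ∧ (∀ H ∈ ℋ, IsCut 𝓛 P H ∧ IsRationalHalfspace H) ∧
      (⋂ L ∈ 𝓛, R L P) = ⋂₀ ℋ := by
  classical
  obtain ⟨I, J, _, _, p, e, hpF, heF, hpP, heP, hvalid⟩ := hP.exists_generators
  have hconv := hP.convex
  obtain ⟨D, hD, hDint⟩ := exists_common_denominator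
    (Sum.elim (fun x : I × Fin d => p x.1 x.2) (fun x : J × Fin d => e x.1 x.2))
    (by rintro (x | x); exacts [hpF _ _, heF _ _])
  have hpD : ∀ i j, ∃ z : ℤ, (D : ℝ) * p i j = z := fun i j => hDint (.inl (i, j))
  have heD : ∀ i j, ∃ z : ℤ, (D : ℝ) * e i j = z := fun i j => hDint (.inr (i, j))
  set N : ℝ := ((M * D).factorial : ℝ) with hNdef
  have hN : 0 < N := by rw [hNdef]; exact_mod_cast Nat.factorial_pos _
  have htable : ∀ L, ∃ k : I → I ⊕ J → ℕ, L ∈ 𝓛 → BoundsExit p e N k (interior L) ∧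
      ∀ i, p i ∈ interior L → ∀ u, 0 < k i u → p i + (N / k i u) •
        Sum.elim (fun i' => p i' - p i) e u ∉ interior L := by
    intro L
    by_cases hL : L ∈ 𝓛
    · obtain ⟨m, hm, hwidth⟩ := h𝓛 L hL
      obtain ⟨k, hk⟩ := hwidth.exists_exit_table hD hm hpD heD
      exact ⟨k, fun _ => hk⟩
    · exact ⟨0, fun h => absurd h hL⟩
  choose k hk using htable
  have houter : ∀ L, ∃ U : Set (Fin (d + 1) → ℝ), L ∈ 𝓛 → U.Finite ∧
      (∀ r ∈ U, ∀ j, r j ∈ rationals) ∧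
      (∀ r ∈ U, (∀ y ∈ exitPoints p e N {i | p i ∈ interior L} (k L),
        0 ≤ vecHead r + vecTail r ⬝ᵥ y) ∧ ∀ j, 0 ≤ vecTail r ⬝ᵥ e j) ∧
      ∀ x, (∀ r ∈ U, 0 ≤ vecHead r + vecTail r ⬝ᵥ x) → x ∈ R L P := by
    intro L
    by_cases hL : L ∈ 𝓛
    · obtain ⟨m, hm, hwidth⟩ := h𝓛 L hL
      obtain ⟨U, hU⟩ := exists_outer_description rationals (S := exitPoints p e N
        {i | p i ∈ interior L} (k L)) (C := R L P) (e := e) (exitPoints_finite _ _ _ _ _)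
        (exitPoints_mem hpF heF (natCast_mem _ _)) heF (convex_convexHull ℝ _)
        ((exitPoints_subset hN hconv hpP heP (hk L hL).1 (hk L hL).2).trans
          (subset_convexHull ℝ _))
        (fun x hx j => R_add_smul_mem hwidth (fun x hx => heP x hx j) x hx)
      exact ⟨U, fun _ => hU⟩
    · exact ⟨∅, fun h => absurd h hL⟩
  choose U hU using houter
  -- Used twice: with `L₀` dominated by `L` it gives monotonicity of `R`, and with `L₀ = L` it shows
  -- that the forms in `U L` define cuts.
  have hcompare : ∀ L₀ ∈ 𝓛, ∀ L ∈ 𝓛, (∀ i, p i ∈ interior L₀ ↔ p i ∈ interior L) →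
      (∀ i u, k L₀ i u ≤ k L i u) → ∀ r ∈ U L, ∀ x ∈ P \ interior L₀,
      0 ≤ vecHead r + vecTail r ⬝ᵥ x := by
    intro L₀ hL₀ L hL hW hle r hr x hx
    obtain ⟨h1, h2⟩ := (hU L hL).2.2.1 r hr
    have := valid_of_valid_on_exitPoints (k' := k L) hN hvalid (hk L₀ hL₀).1 hle (h := -vecTail r)
      (γ := vecHead r) (fun y hy => ?_) (fun j => ?_) x hx
    · rw [neg_dotProduct] at this; linarith
    · rw [show {i | p i ∈ interior L₀} = {i | p i ∈ interior L} from Set.ext hW] at hy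
      have := h1 y hy
      rw [neg_dotProduct]; linarith
    · have := h2 j
      rw [neg_dotProduct]; linarith
  have hmono : ∀ L₀ ∈ 𝓛, ∀ L ∈ 𝓛, (∀ i, p i ∈ interior L₀ ↔ p i ∈ interior L) →
      (∀ i u, k L₀ i u ≤ k L i u) → R L₀ P ⊆ R L P := fun L₀ hL₀ L hL hW hle =>
    convexHull_min (fun x hx => (hU L hL).2.2.2 x fun r hr => hcompare L₀ hL₀ L hL hW hle r hr x hx)
      (convex_convexHull ℝ _)
  -- Both the indicator of the interior points and its complement are recorded, so that domination
  -- forces equality of these sets.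
  obtain ⟨𝓛₀, hsub, hfin, hdom⟩ := exists_finite_dominating 𝓛
    (fun L => Sum.elim (fun i => if p i ∈ interior L then 1 else 0)
      (Sum.elim (fun i => if p i ∈ interior L then 0 else 1) fun x : I × (I ⊕ J) => k L x.1 x.2))
  have hinter : (⋂ L ∈ 𝓛, R L P) = ⋂ L ∈ 𝓛₀, R L P := by
    refine Set.Subset.antisymm (Set.biInter_subset_biInter_left hsub) ?_
    refine Set.subset_iInter₂ fun L hL => ?_
    obtain ⟨L₀, hL₀, hle⟩ := hdom L hL
    refine (Set.biInter_subset_of_mem hL₀).trans (hmono L₀ (hsub hL₀) L hL (fun i => ?_)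
      fun i u => hle (.inr (.inr (i, u))))
    have h1 := hle (.inl i)
    have h2 := hle (.inr (.inl i))
    simp only [Sum.elim_inl, Sum.elim_inr] at h1 h2
    by_cases h3 : p i ∈ interior L₀ <;> by_cases h4 : p i ∈ interior L <;> simp [h3, h4] at h1 h2 ⊢
  have hcuts : ∀ L, ∃ ℋ : Set (Set (Fin d → ℝ)), L ∈ 𝓛₀ → ℋ.Finite ∧
      (∀ H ∈ ℋ, IsCut 𝓛 P H ∧ IsRationalHalfspace H) ∧ R L P = ⋂₀ ℋ := by
    intro L
    by_cases hL₀ : L ∈ 𝓛₀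
    swap
    · exact ⟨∅, fun h => absurd h hL₀⟩
    have hL := hsub hL₀
    -- A width representation contains at least one nonzero integer vector, which excludes dimension
    -- 0.
    have hd : 0 < d := by
      obtain ⟨m, -, n, a, b, hn, ha, -⟩ := h𝓛 L hL
      by_contra h0
      obtain rfl : d = 0 := by omega
      exact ha ⟨0, hn⟩ (Subsingleton.elim _ _)
    obtain ⟨ℋ, hfin, hℋ, heq⟩ := exists_halfspaces_of_forms hd (hU L hL).1 (hU L hL).2.1
    have hsub : P \ interior L ⊆ ⋂₀ ℋ := fun x hx => by
      rw [heq]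
      exact fun r hr => hcompare L hL L hL (fun _ => Iff.rfl) (fun _ _ => le_rfl) r hr x hx
    refine ⟨ℋ, fun _ => ⟨hfin, fun H hH => ⟨⟨(hℋ H hH).isClosedHalfspace, L, hL,
      hsub.trans (Set.sInter_subset_of_mem hH)⟩, hℋ H hH⟩, ?_⟩⟩
    refine Set.Subset.antisymm (convexHull_min hsub
      (isRationalPolyhedron_sInter hfin hℋ).convex) ?_
    rw [heq]
    exact fun x hx => (hU L hL).2.2.2 x hx
  choose ℋ hℋ using hcuts
  refine ⟨⋃ L ∈ 𝓛₀, ℋ L, hfin.biUnion fun L hL => (hℋ L hL).1, fun H hH => ?_, ?_⟩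
  · obtain ⟨L, hL, hH⟩ := Set.mem_iUnion₂.1 hH
    exact (hℋ L hL).2.1 H hH
  · rw [hinter, Set.sInter_iUnion]
    refine Set.iInter_congr fun L => ?_
    rw [Set.sInter_iUnion]
    exact Set.iInter_congr fun hL => (hℋ L hL).2.2

/-! ### Split closure and Chvátal–Gomory closure -/

/-- A split set has a representation of width one. -/
theorem hasWidthRepresentation_one_of_mem_splitSets {d : ℕ} {L : Set (Fin d → ℝ)}
    (hL : L ∈ splitSets d) : HasWidthRepresentation L 1 := by
  obtain ⟨a, i, ha, rfl⟩ := hL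
  exact ⟨1, fun _ => a, fun _ => i, le_rfl, fun _ => ha, by ext x; simp⟩

theorem isRationalPolyhedron_iInter_R_of_splitSets {d : ℕ} {P : Set (Fin d → ℝ)}
    (hP : IsRationalPolyhedron P) {𝓛 : Set (Set (Fin d → ℝ))} (h𝓛 : 𝓛 ⊆ splitSets d) :
    IsRationalPolyhedron (⋂ L ∈ 𝓛, R L P) := by
  obtain ⟨ℋ, hfin, hℋ, heq⟩ := exists_finite_rational_cuts (M := 1) hP fun L hL =>
    ⟨1, le_rfl, hasWidthRepresentation_one_of_mem_splitSets (h𝓛 hL)⟩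
  rw [heq]
  exact isRationalPolyhedron_sInter hfin fun H hH => (hℋ H hH).2

/-- If `⟨a, x⟩ ≤ b` is valid on `P`, then the split set above `⌊b⌋` yields the rounded cut. -/
theorem R_split_eq {d : ℕ} {P : Set (Fin d → ℝ)} (hP : Convex ℝ P) {a : Fin d → ℤ} (ha : a ≠ 0)
    {b : ℝ} (hab : ∀ y ∈ P, (fun j => (a j : ℝ)) ⬝ᵥ y ≤ b) :
    R {x | ((⌊b⌋ + 1 : ℤ) : ℝ) - 1 ≤ (fun j => (a j : ℝ)) ⬝ᵥ x ∧
      (fun j => (a j : ℝ)) ⬝ᵥ x ≤ ((⌊b⌋ + 1 : ℤ) : ℝ)} P =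
    P ∩ {x | (fun j => (a j : ℝ)) ⬝ᵥ x ≤ ⌊b⌋} := by
  rw [R, interior_strip ha]
  have hset : P \ {x | ((⌊b⌋ + 1 : ℤ) : ℝ) - 1 < (fun j => (a j : ℝ)) ⬝ᵥ x ∧
      (fun j => (a j : ℝ)) ⬝ᵥ x < ((⌊b⌋ + 1 : ℤ) : ℝ)} =
      P ∩ {x | (fun j => (a j : ℝ)) ⬝ᵥ x ≤ ⌊b⌋} := by
    ext x
    simp only [Set.mem_sdiff, Set.mem_inter_iff, Set.mem_ofPred_eq, not_and_or, not_lt]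
    refine and_congr_right fun hx => ?_
    -- `P` lies strictly below the upper face of the split, so only its lower side survives.
    have := (hab x hx).trans_lt (Int.lt_floor_add_one b)
    push_cast
    constructor
    · rintro (h | h) <;> linarith
    · intro h; left; linarith
  rw [hset]
  refine (hP.inter fun x hx y hy s t hs ht hst => ?_).convexHull_eq
  simp only [Set.mem_ofPred_eq, dotProduct_add, dotProduct_smul, smul_eq_mul] at hx hy ⊢
  have h1 := mul_le_mul_of_nonneg_left hx hs
  have h2 := mul_le_mul_of_nonneg_left hy ht
  have : s * (⌊b⌋ : ℝ) + t * ⌊b⌋ = ⌊b⌋ := by rw [← add_mul, hst, one_mul]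
  linarith

theorem isRationalPolyhedron_chvatalGomoryClosure {d : ℕ} {P : Set (Fin d → ℝ)}
    (hP : IsRationalPolyhedron P) : IsRationalPolyhedron (chvatalGomoryClosure P) := by
  -- A point of `P` is needed for the case `a = 0`, where it yields `0 ≤ b` and hence `0 ≤ ⌊b⌋`.
  rcases P.eq_empty_or_nonempty with rfl | ⟨y₀, hy₀⟩
  · convert hP
    exact Set.eq_empty_of_forall_notMem fun x hx => hx.1
  let 𝓛 : Set (Set (Fin d → ℝ)) := {L | ∃ (a : Fin d → ℤ) (b : ℝ), a ≠ 0 ∧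
    (∀ y ∈ P, (fun j => (a j : ℝ)) ⬝ᵥ y ≤ b) ∧
    L = {x | ((⌊b⌋ + 1 : ℤ) : ℝ) - 1 ≤ (fun j => (a j : ℝ)) ⬝ᵥ x ∧
      (fun j => (a j : ℝ)) ⬝ᵥ x ≤ ((⌊b⌋ + 1 : ℤ) : ℝ)}}
  have h𝓛 : 𝓛 ⊆ splitSets d := by
    rintro _ ⟨a, b, ha, -, rfl⟩
    exact ⟨a, ⌊b⌋ + 1, ha, rfl⟩
  convert hP.inter (isRationalPolyhedron_iInter_R_of_splitSets hP h𝓛) using 1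
  ext x
  refine and_congr_right fun hx => ?_
  rw [Set.mem_iInter₂]
  constructor
  · rintro h _ ⟨a, b, ha, hab, rfl⟩
    rw [R_split_eq hP.convex ha hab]
    exact ⟨hx, h a b hab⟩
  · intro h a b hab
    rcases eq_or_ne a 0 with rfl | ha
    · have := hab y₀ hy₀
      simp only [Pi.zero_apply, Int.cast_zero] at this ⊢
      rw [show (fun _ : Fin d => (0 : ℝ)) = 0 from rfl, zero_dotProduct] at this ⊢
      exact_mod_cast Int.floor_nonneg.2 this
    · have := h _ ⟨a, b, ha, hab, rfl⟩
      rw [R_split_eq hP.convex ha hab] at this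
      exact this.2

end CutClosure

theorem corollary1 (d : ℕ) (P : Set (Fin d → ℝ)) (hP : CutClosure.IsRationalPolyhedron P) :
    (∀ 𝓛 : Set (Set (Fin d → ℝ)),
      (∀ L ∈ 𝓛, CutClosure.IsRationalPolyhedron L ∧ CutClosure.IsFullDimensional L) →
      CutClosure.familyMaxFacetWidth 𝓛 < ⊤ →
      (∃ ℋ : Set (Set (Fin d → ℝ)), ℋ.Finite ∧
        (∀ H ∈ ℋ, CutClosure.IsCut 𝓛 P H ∧ CutClosure.IsRationalHalfspace H) ∧
        (⋂ L ∈ 𝓛, CutClosure.R L P) = ⋂₀ ℋ) ∧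
      CutClosure.IsRationalPolyhedron (⋂ L ∈ 𝓛, CutClosure.R L P)) ∧
    CutClosure.IsRationalPolyhedron (CutClosure.chvatalGomoryClosure P) ∧
    CutClosure.IsRationalPolyhedron (CutClosure.splitClosure P) := by
  refine ⟨fun 𝓛 _ hwidth => ?_, CutClosure.isRationalPolyhedron_chvatalGomoryClosure hP,
    CutClosure.isRationalPolyhedron_iInter_R_of_splitSets hP subset_rfl⟩
  obtain ⟨M, hM⟩ := ENat.ne_top_iff_exists.1 hwidth.ne
  obtain ⟨ℋ, hfin, hℋ, heq⟩ := CutClosure.exists_finite_rational_cuts (M := M) hP fun L hL => by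
    obtain ⟨-, -, m, hm, -, h⟩ := CutClosure.maxFacetWidth_le_iff.1
      ((le_iSup₂ (f := fun L (_ : L ∈ 𝓛) => CutClosure.maxFacetWidth L) L hL).trans hM.ge)
    exact ⟨m, hm, h⟩
  refine ⟨⟨ℋ, hfin, hℋ, heq⟩, ?_⟩
  rw [heq]
  exact CutClosure.isRationalPolyhedron_sInter hfin fun H hH => (hℋ H hH).2
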